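/- Let $S=K[x_1,\dots,x_n]$ be a polynomial ring over a field. For a homogeneous ideal $I$ let $e(S/I)$ denote the multiplicity of $S/I$, i.e. $\delta!$ times the leading coefficient of the polynomial of degree $\delta=\dim S/I$ which agrees with $t\mapsto\sum_{i\le t}\dim_K (S/I)_i$ for all large $t$ (and $e(S/I)=0$ if $I=S$). A monomial ideal $M$ with minimal monomial generating set $G$ is called dominant if for every $m\in G$ there is a variable $x$ whose exponent in $m$ is strictly larger than its exponent in every $m'\in G\setminus\{m\}$. Theorem. Let $M\subset S$ be a dominant monomial ideal with $\operatorname{codim}(S/M)=c$, and suppose that $M=(m_1,\dots,m_d,h_1,\dots,h_c)$ with monomials $m_i,h_i$ such that $(h_1,\dots,h_c)$ is a complete intersection (i.e. $h_1,\dots,h_c$ is a regular sequence). For a monomial $\bar m$ put $M_{\bar m}=(h_1',\dots,h_c')$, where $h_i'=\operatorname{lcm}(\bar m,h_i)/\bar m$. Then $$e(S/M)=\sum_{A\subseteq\{1,\dots,d\}}(-1)^{|A|}\,e\bigl(S/M_{\operatorname{lcm}(m_r:\,r\in A)}\bigr),$$ where the lcm of the empty family is $1$. If moreover $m_1,\dots,m_d,h_1,\dots,h_c$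 are pairwise distinct and form the minimal monomial generating set of $M$, and $C$ denotes the set of all pairs $(j,\bar m)$ for which there are $1\le r_1<\dots<r_j\le d$ with $\bar m=\operatorname{lcm}(m_{r_1},\dots,m_{r_j})$, $j\ge 1$, together with the pair $(0,1)$, then $$e(S/M)=\sum_{(j,\bar m)\in C}(-1)^{j}\,e(S/M_{\bar m}).$$ -/

import Mathlib

noncomputable section

namespace MonomialMultiplicity

open MvPolynomial

/-- The ideal of `K[x₁, …, xₙ]` generated by the monomials `x ^ a`, `a ∈ G`. Monomials are recorded
by their exponent vectors: divisibility is `≤`, the lcm is `⊔`, the monomial `1` is `0`, and the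
quotient of a monomial by one of its divisors is `-`. -/
def monomialIdeal (K : Type*) [Field K] {n : ℕ} (G : Set (Fin n →₀ ℕ)) :
    Ideal (MvPolynomial (Fin n) K) :=
  Ideal.span ((fun a => monomial a (1 : K)) '' G)

/-- `G` is a minimal set of monomials generating the ideal `M`. -/
def IsMinimalMonomialGenSet {K : Type*} [Field K] {n : ℕ} (M : Ideal (MvPolynomial (Fin n) K))
    (G : Set (Fin n →₀ ℕ)) : Prop :=
  Minimal (fun G' : Set (Fin n →₀ ℕ) => monomialIdeal K G' = M) G

/-- The monomial `a` is dominant in `G`: some variable has a strictly larger exponent in `a` than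
in every other element of `G`. -/
def IsDominantIn {n : ℕ} (G : Set (Fin n →₀ ℕ)) (a : Fin n →₀ ℕ) : Prop :=
  ∃ x : Fin n, ∀ b ∈ G \ {a}, b x < a x

/-- `M` is a dominant (monomial) ideal: every element of its minimal monomial generating set is
dominant in that set. -/
def IsDominantIdeal {K : Type*} [Field K] {n : ℕ} (M : Ideal (MvPolynomial (Fin n) K)) : Prop :=
  ∃ G : Set (Fin n →₀ ℕ), IsMinimalMonomialGenSet M G ∧ ∀ a ∈ G, IsDominantIn G a

/-- `dim_K (S/I)_i`, the dimension of the image in `S/I` of the forms of degree `i`. -/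
def hilbertFunction {K : Type*} [Field K] {n : ℕ} (I : Ideal (MvPolynomial (Fin n) K)) (i : ℕ) :
    ℕ :=
  Module.finrank K ((homogeneousSubmodule (Fin n) K i).map (Ideal.Quotient.mkₐ K I).toLinearMap)

/-- `P(t) = ∑_{i ≤ t} dim_K (S/I)_i` for all large `t`. For homogeneous `I ≠ S` such a `P` exists,
and its degree is `dim S/I`. -/
def IsHilbertSamuelPolynomial {K : Type*} [Field K] {n : ℕ} (I : Ideal (MvPolynomial (Fin n) K))
    (P : Polynomial ℚ) : Prop :=
  ∀ᶠ t : ℕ in Filter.atTop,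
    P.eval (t : ℚ) = ∑ i ∈ Finset.range (t + 1), (hilbertFunction I i : ℚ)

theorem IsHilbertSamuelPolynomial.unique {K : Type*} [Field K] {n : ℕ}
    {I : Ideal (MvPolynomial (Fin n) K)} {P Q : Polynomial ℚ}
    (hP : IsHilbertSamuelPolynomial I P) (hQ : IsHilbertSamuelPolynomial I Q) : P = Q := by
  obtain ⟨N, hN⟩ := Filter.eventually_atTop.1 (hP.and hQ)
  refine Polynomial.eq_of_infinite_eval_eq P Q ?_
  refine Set.Infinite.mono (s := (fun t : ℕ => (t : ℚ)) '' Set.Ici N) ?_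
    ((Set.Ici_infinite N).image Nat.cast_injective.injOn)
  rintro _ ⟨t, ht, rfl⟩
  exact (hN t ht).1.trans (hN t ht).2.symm

open Classical in
/-- The multiplicity `e(S/I)` for homogeneous `I`: `d!` times the leading coefficient of the
polynomial `P` of degree `d` with `P(t) = ∑_{i ≤ t} dim_K (S/I)_i` for all large `t`. If
`d = dim S/I > 0` this is `(d - 1)!` times the leading coefficient of the Hilbert polynomial of
`S/I`; if `S/I` has finite length it is `dim_K S/I` (and `0` if `I = S`). -/
def hilbertMultiplicity {K : Type*} [Field K] {n : ℕ} (I : Ideal (MvPolynomial (Fin n) K)) : ℚ :=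
  if hI : ∃ P : Polynomial ℚ, IsHilbertSamuelPolynomial I P then
    (hI.choose.natDegree.factorial : ℚ) * hI.choose.leadingCoeff
  else 0

theorem hilbertMultiplicity_eq {K : Type*} [Field K] {n : ℕ} {I : Ideal (MvPolynomial (Fin n) K)}
    {P : Polynomial ℚ} (hP : IsHilbertSamuelPolynomial I P) :
    hilbertMultiplicity I = (P.natDegree.factorial : ℚ) * P.leadingCoeff := by
  have hI : ∃ P : Polynomial ℚ, IsHilbertSamuelPolynomial I P := ⟨P, hP⟩
  rw [hilbertMultiplicity, dif_pos hI, hI.choose_spec.unique hP]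

/-- The ideal `M_b = (h'₁, …, h'_c)` with `h'ᵢ = lcm(b, hᵢ) / b`. -/
def quotientIdeal (K : Type*) [Field K] {n c : ℕ} (h : Fin c → (Fin n →₀ ℕ)) (b : Fin n →₀ ℕ) :
    Ideal (MvPolynomial (Fin n) K) :=
  monomialIdeal K (Set.range fun i => (b ⊔ h i) - b)

/-- The set `C` of pairs `(j, b)` such that `b` is the lcm of `j` of the monomials `m₁, …, m_d`
(with distinct indices); `j = 0` contributes the pair `(0, 1)`. -/
def lcmPairs {n d : ℕ} (m : Fin d → (Fin n →₀ ℕ)) : Finset (ℕ × (Fin n →₀ ℕ)) :=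
  Finset.univ.image fun s : Finset (Fin d) => (s.card, s.sup m)

end MonomialMultiplicity

end

/-! For a monomial ideal, `∑_{i ≤ t} dim (S/I)_i` counts the standard monomials of degree at most
`t`. Those of `M` are the standard monomials of `(h)` divisible by no `mᵢ`. Inclusion–exclusion over
sets `A` of the `mᵢ`, followed by division by `lcm(A)`, writes this count as an alternating sum of
the counts for `M_{lcm(A)}` at `t - deg lcm(A)` (`standardCount_union`).

All terms can be compared in degree `n - c`. The `h'ᵢ` inherit disjoint supports from the `hᵢ`, so
each `M_{lcm(A)}` has Hilbert–Samuel polynomial `0` or of degree exactly `n - c`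
(`eq_zero_or_natDegree_eq`). Since `M` has height `c`, it lies in an ideal generated by at most `c`
variables, so its polynomial also has degree `n - c` and the top coefficients do not cancel.
Translation in `t` leaves the coefficient of `t ^ (n - c)` unchanged, and comparing these
coefficients gives the first formula.

In the second formula dominance makes `A ↦ (|A|, lcm(A))` injective, so the sum over pairs is the
sum over subsets. -/

namespace MonomialMultiplicity

open MvPolynomial

/-! ### Counting standard monomials by inclusion–exclusion -/

/-- The exponent vectors of degree at most `t`. -/
noncomputable def degreeLE (σ : Type*) [Fintype σ] (t : ℕ) : Finset (σ →₀ ℕ) :=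
  (Finsupp.finite_of_degree_le (σ := σ) t).toFinset

@[simp]
theorem mem_degreeLE {σ : Type*} [Fintype σ] {t : ℕ} {a : σ →₀ ℕ} :
    a ∈ degreeLE σ t ↔ a.degree ≤ t := by
  simp [degreeLE]

theorem card_degreeLE (σ : Type*) [Fintype σ] (t : ℕ) :
    (degreeLE σ t).card = (t + Fintype.card σ).choose (Fintype.card σ) := by
  classical
  have key : (degreeLE σ t).card = (Fintype.card σ + 1).multichoose t := by
    induction t with
    | zero =>
      have : degreeLE σ 0 = {0} := by
        ext a
        simp [Finsupp.degree_eq_zero_iff]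
      simp [this]
    | succ t ih =>
      have hsplit : degreeLE σ (t + 1) =
          degreeLE σ t ∪ Finset.univ.finsuppAntidiag (t + 1) := by
        ext a
        simp only [mem_degreeLE, Finset.mem_union, Finset.mem_finsuppAntidiag,
          Finset.subset_univ, and_true, ← Finsupp.degree_eq_sum]
        omega
      have hdisj : Disjoint (degreeLE σ t) (Finset.univ.finsuppAntidiag (t + 1)) := by
        rw [Finset.disjoint_left]
        intro a ha hb
        simp only [mem_degreeLE, Finset.mem_finsuppAntidiag,
          Finset.subset_univ, and_true, ← Finsupp.degree_eq_sum] at ha hb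
        omega
      rw [hsplit, Finset.card_union_of_disjoint hdisj, ih,
        Finset.card_finsuppAntidiag_nat_eq_multichoose, Nat.multichoose_succ_succ,
        Finset.card_univ, add_comm]
  rw [key, Nat.multichoose_eq, add_right_comm, Nat.add_sub_cancel, add_comm t,
    Nat.choose_symm_add]

open Classical in
/-- The number of monomials of degree at most `t` divisible by no element of `G`. -/
noncomputable def standardCount {n : ℕ} (G : Set (Fin n →₀ ℕ)) (t : ℕ) : ℕ :=
  ((degreeLE (Fin n) t).filter fun a => ∀ g ∈ G, ¬ g ≤ a).card

/-- Inclusion–exclusion for the multiples of finitely many monomials. -/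
theorem sum_neg_one_pow_sup_le {n : ℕ} {ι : Type*} [Fintype ι] (m : ι → (Fin n →₀ ℕ))
    (a : Fin n →₀ ℕ) [Decidable (∀ i, ¬ m i ≤ a)] [∀ s : Finset ι, Decidable (s.sup m ≤ a)] :
    ∑ s : Finset ι, (-1 : ℚ) ^ s.card * (if s.sup m ≤ a then 1 else 0) =
      if ∀ i, ¬ m i ≤ a then 1 else 0 := by
  classical
  -- The lcm of `s` divides `a` exactly when `s ⊆ T`, so the sum is the alternating sum over the
  -- subsets of `T`, which vanishes unless `T` is empty.
  set T : Finset ι := Finset.univ.filter fun i => m i ≤ a with hT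
  have hle : ∀ s : Finset ι, s.sup m ≤ a ↔ s ∈ T.powerset := by
    intro s
    rw [Finset.sup_le_iff, Finset.mem_powerset]
    simp [hT, Finset.subset_iff]
  have hz := Finset.sum_powerset_neg_one_pow_card (x := T)
  have hcast : ∑ s ∈ T.powerset, (-1 : ℚ) ^ s.card = if T = ∅ then 1 else 0 := by
    have := congrArg (Int.cast : ℤ → ℚ) hz
    push_cast at this
    exact this
  have hTe : T = ∅ ↔ ∀ i, ¬ m i ≤ a := by
    simp [hT, Finset.filter_eq_empty_iff]
  simp only [mul_ite, mul_one, mul_zero, hle]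
  rw [← Finset.sum_filter]
  simp only [Finset.filter_mem_eq_inter, Finset.univ_inter, hcast, hTe]

open Classical in
theorem card_filter_not_le {n : ℕ} {ι : Type*} [Fintype ι] (m : ι → (Fin n →₀ ℕ))
    (B : Finset (Fin n →₀ ℕ)) :
    ((B.filter fun a => ∀ i, ¬ m i ≤ a).card : ℚ) =
      ∑ s : Finset ι, (-1 : ℚ) ^ s.card * (B.filter fun a => s.sup m ≤ a).card := by
  simp only [Finset.card_filter, Nat.cast_sum, Nat.cast_ite, Nat.cast_one, Nat.cast_zero]
  simp only [Finset.mul_sum]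
  rw [Finset.sum_comm]
  refine Finset.sum_congr rfl fun a _ => ?_
  exact (sum_neg_one_pow_sup_le m a).symm

-- Division by `b` is a bijection: `h i` divides `y + b` iff `lcm(b, h i) / b` divides `y`, and
-- degrees drop by `b.degree`.
open Classical in
theorem card_filter_le_eq_standardCount {n : ℕ} {ι : Type*} (h : ι → (Fin n →₀ ℕ))
    (b : Fin n →₀ ℕ) {t : ℕ} (ht : b.degree ≤ t) :
    (((degreeLE (Fin n) t).filter fun a => ∀ i, ¬ h i ≤ a).filter fun a => b ≤ a).card =
      standardCount (Set.range fun i => (b ⊔ h i) - b) (t - b.degree) := by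
  have hiff : ∀ i y, (b ⊔ h i) - b ≤ y ↔ h i ≤ y + b := by
    intro i y
    rw [tsub_le_iff_right, sup_le_iff]
    exact ⟨fun H => H.2, fun H => ⟨le_add_self, H⟩⟩
  symm
  refine Finset.card_bij (fun y _ => y + b) ?_ ?_ ?_
  · intro y hy
    simp only [Finset.mem_filter, mem_degreeLE, Set.forall_mem_range, hiff] at hy
    simp only [Finset.mem_filter, mem_degreeLE, map_add]
    exact ⟨⟨by omega, hy.2⟩, le_add_self⟩
  · intro y _ z _ hyz
    exact add_right_cancel hyz
  · intro a ha
    simp only [Finset.mem_filter, mem_degreeLE] at ha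
    have hab : a - b + b = a := tsub_add_cancel_of_le ha.2
    have hdeg : (a - b).degree + b.degree = a.degree := by rw [← map_add, hab]
    refine ⟨a - b, ?_, hab⟩
    simp only [Finset.mem_filter, mem_degreeLE, Set.forall_mem_range, hiff, hab]
    exact ⟨by omega, ha.1.2⟩

/-- Counting the standard monomials of `(m, h)` by means of those of the ideals `(h) : lcm`. -/
theorem standardCount_union {n : ℕ} {ι κ : Type*} [Fintype ι] (m : ι → (Fin n →₀ ℕ))
    (h : κ → (Fin n →₀ ℕ)) {t : ℕ} (ht : ∀ s : Finset ι, (s.sup m).degree ≤ t) :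
    (standardCount (Set.range m ∪ Set.range h) t : ℚ) =
      ∑ s : Finset ι, (-1 : ℚ) ^ s.card *
        standardCount (Set.range fun i => (s.sup m ⊔ h i) - s.sup m) (t - (s.sup m).degree) := by
  classical
  have : standardCount (Set.range m ∪ Set.range h) t =
      (((degreeLE (Fin n) t).filter fun a => ∀ i, ¬ h i ≤ a).filter
        fun a => ∀ i, ¬ m i ≤ a).card := by
    rw [standardCount, Finset.filter_filter]
    congr 1
    ext a
    simp only [Finset.mem_filter, Set.mem_union, or_imp, forall_and, Set.forall_mem_range]
    tauto
  rw [this, card_filter_not_le]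
  refine Finset.sum_congr rfl fun s _ => ?_
  rw [card_filter_le_eq_standardCount h _ (ht s)]

theorem standardCount_range_empty {n : ℕ} {κ : Type*} [IsEmpty κ] (h : κ → (Fin n →₀ ℕ)) (t : ℕ) :
    standardCount (Set.range h) t = (t + n).choose n := by
  classical
  rw [standardCount, Set.range_eq_empty]
  simp [card_degreeLE]

/-- `standardCount` is eventually a polynomial. -/
theorem exists_polynomial_standardCount {n : ℕ} {ι : Type*} [Fintype ι] (m : ι → (Fin n →₀ ℕ)) :
    ∃ P : Polynomial ℚ, ∀ᶠ t : ℕ in Filter.atTop,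
      P.eval (t : ℚ) = standardCount (Set.range m) t := by
  refine ⟨∑ s : Finset ι, (-1 : ℚ) ^ s.card • Polynomial.preHilbertPoly ℚ n (s.sup m).degree, ?_⟩
  filter_upwards [Filter.eventually_all.2 fun s : Finset ι =>
    Filter.eventually_ge_atTop (s.sup m).degree] with t ht
  -- With no `h` at all, each term counts all monomials of degree at most `t - deg lcm`, a binomial
  -- coefficient polynomial in `t`.
  have h := standardCount_union m (fun i : Empty => i.elim) ht
  rw [Set.range_eq_empty (fun i : Empty => (i.elim : Fin n →₀ ℕ)), Set.union_empty] at h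
  rw [h, Polynomial.eval_finsetSum]
  refine Finset.sum_congr rfl fun s _ => ?_
  rw [standardCount_range_empty, Polynomial.eval_smul, smul_eq_mul,
    Polynomial.preHilbertPoly_eq_choose_sub_add ℚ n (ht s)]

/-! ### Growth bounds for the count -/

/-- Every generator involves a variable of `X`, so all monomials in the other variables are
standard. -/
theorem choose_le_standardCount {n : ℕ} {G : Set (Fin n →₀ ℕ)} (X : Finset (Fin n))
    (hX : ∀ g ∈ G, ∃ x ∈ X, g x ≠ 0) (t : ℕ) :
    (t + (n - X.card)).choose (n - X.card) ≤ standardCount G t := by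
  classical
  have hcard : Fintype.card {x // x ∉ X} = n - X.card := by
    rw [Fintype.card_subtype_compl]
    simp
  rw [← hcard, ← card_degreeLE, standardCount]
  refine Finset.card_le_card_of_injOn (Finsupp.mapDomain Subtype.val) ?_
    (Finsupp.mapDomain_injective Subtype.val_injective).injOn
  intro a ha
  simp only [Finset.mem_coe, mem_degreeLE] at ha
  simp only [Finset.coe_filter, Set.mem_ofPred_eq, mem_degreeLE]
  refine ⟨(Finsupp.degree_mapDomain _ _).trans_le ha, fun g hg hle => ?_⟩
  obtain ⟨x, hx, hgx⟩ := hX g hg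
  have h0 : Finsupp.mapDomain Subtype.val a x = 0 :=
    Finsupp.mapDomain_of_notMem_range a x (by simpa using hx)
  have := hle x
  omega

theorem card_piFinset_injective {n c : ℕ} {f : Fin c → Fin n} (hf : f.Injective) (D t : ℕ)
    [DecidablePred (· ∈ Set.range f)] :
    (Fintype.piFinset fun x : Fin n =>
      if x ∈ Set.range f then Finset.range D else Finset.range (t + 1)).card =
      D ^ c * (t + 1) ^ (n - c) := by
  classical
  rw [Fintype.card_piFinset]
  simp only [apply_ite Finset.card, Finset.card_range]
  rw [Finset.prod_ite, Finset.prod_const, Finset.prod_const]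
  have h1 : (Finset.univ.filter fun x => x ∈ Set.range f).card = c := by
    have : (Finset.univ.filter fun x => x ∈ Set.range f) = Finset.univ.image f := by
      ext x
      simp
    rw [this, Finset.card_image_of_injective _ hf, Finset.card_univ, Fintype.card_fin]
  have h2 : (Finset.univ.filter fun x => ¬ x ∈ Set.range f).card = n - c := by
    have := Finset.card_filter_add_card_filter_not (s := Finset.univ) fun x => x ∈ Set.range f
    rw [h1, Finset.card_univ, Fintype.card_fin] at this
    omega
  rw [h1, h2]

/-- If no `h i` divides `a`, each `i` has a variable `f i` whose exponent in `a` is below that in `h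
i`. Disjoint supports make `f` injective, so `a` lies in one of finitely many boxes with `c` sides
of bounded length and `n - c` sides of length `t + 1`. -/
theorem exists_standardCount_le {n c : ℕ} (h : Fin c → (Fin n →₀ ℕ))
    (hdisj : ∀ i j x, h i x ≠ 0 → h j x ≠ 0 → i = j) :
    ∃ E : ℕ, ∀ t, standardCount (Set.range h) t ≤ E * (t + 1) ^ (n - c) := by
  classical
  set D := ∑ i, (h i).degree with hD
  set F : Finset (Fin c → Fin n) := Finset.univ.filter fun f => f.Injective
  refine ⟨F.card * D ^ c, fun t => ?_⟩
  let box : (Fin c → Fin n) → Finset (Fin n → ℕ) := fun f =>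
    Fintype.piFinset fun x : Fin n =>
      if x ∈ Set.range f then Finset.range D else Finset.range (t + 1)
  calc standardCount (Set.range h) t ≤ (F.biUnion box).card := by
        refine Finset.card_le_card_of_injOn (fun a => ⇑a) ?_ DFunLike.coe_injective.injOn
        intro a ha
        simp only [Finset.coe_filter, Set.mem_ofPred_eq, mem_degreeLE, Set.forall_mem_range,
          Finsupp.le_def, not_forall, not_le] at ha
        obtain ⟨hdeg, hlt⟩ := ha
        choose f hf using hlt
        rw [Finset.mem_coe, Finset.mem_biUnion]
        refine ⟨f, ?_, ?_⟩
        · rw [Finset.mem_filter]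
          refine ⟨Finset.mem_univ _, fun i j hij => hdisj i j (f i) ?_ ?_⟩
          · have := hf i
            omega
          · have := hf j
            rw [hij]
            omega
        · rw [Fintype.mem_piFinset]
          intro x
          split_ifs with hx
          · obtain ⟨i, rfl⟩ := hx
            rw [Finset.mem_range]
            refine (hf i).trans_le ((Finsupp.le_degree _ _).trans ?_)
            exact Finset.single_le_sum (f := fun i => (h i).degree) (fun _ _ => Nat.zero_le _)
              (Finset.mem_univ i)
          · rw [Finset.mem_range]
            exact Nat.lt_succ_of_le ((Finsupp.le_degree x a).trans hdeg)
    _ ≤ F.card * (D ^ c * (t + 1) ^ (n - c)) := by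
        refine Finset.card_biUnion_le_card_mul _ _ _ fun f hf => ?_
        exact (card_piFinset_injective (Finset.mem_filter.1 hf).2 D t).le
    _ = F.card * D ^ c * (t + 1) ^ (n - c) := (mul_assoc _ _ _).symm

/-- Otherwise `Q / P` tends to `0`, contradicting `0 < P ≤ Q` at large integers. -/
theorem natDegree_le_of_eventually_le {P Q : Polynomial ℚ} (hP : P ≠ 0)
    (h0 : ∀ᶠ t : ℕ in Filter.atTop, 0 ≤ P.eval (t : ℚ))
    (hPQ : ∀ᶠ t : ℕ in Filter.atTop, P.eval (t : ℚ) ≤ Q.eval (t : ℚ)) :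
    P.natDegree ≤ Q.natDegree := by
  by_contra! hlt
  have hlim := (Polynomial.div_tendsto_atTop_zero_of_degree_lt Q P
    (Polynomial.degree_lt_degree hlt)).comp (tendsto_natCast_atTop_atTop (R := ℚ))
  have hroot := (tendsto_natCast_atTop_atTop (R := ℚ)).eventually
    (Polynomial.eventually_atTop_not_isRoot P hP)
  obtain ⟨t, h1, h2, h3, h4⟩ := (h0.and (hPQ.and
    ((hlim.eventually (gt_mem_nhds zero_lt_one)).and hroot))).exists
  have hpos : 0 < P.eval (t : ℚ) := lt_of_le_of_ne h1 (Ne.symm h4)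
  simp only [Function.comp_apply, div_lt_one hpos] at h3
  exact absurd h2 (not_le.2 h3)

/-! ### Hilbert functions of monomial ideals -/

theorem mem_monomialIdeal {K : Type*} [Field K] {n : ℕ} {G : Set (Fin n →₀ ℕ)}
    {f : MvPolynomial (Fin n) K} :
    f ∈ monomialIdeal K G ↔ ∀ a ∈ f.support, ∃ g ∈ G, g ≤ a :=
  mem_ideal_span_monomial_image

theorem monomial_mem_monomialIdeal {K : Type*} [Field K] {n : ℕ} {G : Set (Fin n →₀ ℕ)}
    {a : Fin n →₀ ℕ} :
    monomial a (1 : K) ∈ monomialIdeal K G ↔ ∃ g ∈ G, g ≤ a := by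
  classical
  simp [mem_monomialIdeal, support_monomial]

/-- The standard monomials of a monomial ideal are linearly independent in the quotient. -/
theorem linearIndependent_standardMonomials (K : Type*) [Field K] {n : ℕ}
    (G : Set (Fin n →₀ ℕ)) :
    LinearIndependent K fun a : {a : Fin n →₀ ℕ // ∀ g ∈ G, ¬ g ≤ a} =>
      (Ideal.Quotient.mkₐ K (monomialIdeal K G)).toLinearMap (monomial a.1 (1 : K)) := by
  have hli : LinearIndependent K
      fun a : {a : Fin n →₀ ℕ // ∀ g ∈ G, ¬ g ≤ a} => monomial a.1 (1 : K) := by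
    have := (basisMonomials (Fin n) K).linearIndependent.comp
      (fun a : {a : Fin n →₀ ℕ // ∀ g ∈ G, ¬ g ≤ a} => a.1) Subtype.val_injective
    simpa [Function.comp_def] using this
  refine hli.map (f := (Ideal.Quotient.mkₐ K (monomialIdeal K G)).toLinearMap) ?_
  -- A nonzero element of the span has only standard monomials in its support, while an element of
  -- the ideal has none.
  rw [Submodule.disjoint_def]
  intro f hf hker
  have hf' : f ∈ restrictSupport K {a : Fin n →₀ ℕ | ∀ g ∈ G, ¬ g ≤ a} := by
    refine Submodule.span_le.2 ?_ hf
    rintro _ ⟨a, rfl⟩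
    classical
    rw [SetLike.mem_coe, mem_restrictSupport_iff]
    intro b hb
    rw [Finset.mem_coe, support_monomial, if_neg one_ne_zero, Finset.mem_singleton] at hb
    exact hb ▸ a.2
  have hmem : f ∈ monomialIdeal K G := by
    simpa [Ideal.Quotient.eq_zero_iff_mem] using hker
  rw [mem_monomialIdeal] at hmem
  by_contra hne
  obtain ⟨a, ha⟩ := Finset.nonempty_iff_ne_empty.2 (mt support_eq_empty.1 hne)
  obtain ⟨g, hg, hle⟩ := hmem a ha
  exact ((mem_restrictSupport_iff K).1 hf' ha) g hg hle

theorem hilbertFunction_monomialIdeal (K : Type*) [Field K] {n : ℕ} (G : Set (Fin n →₀ ℕ))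
    (i : ℕ) :
    hilbertFunction (monomialIdeal K G) i =
      Nat.card {a : Fin n →₀ ℕ // a.degree = i ∧ ∀ g ∈ G, ¬ g ≤ a} := by
  set φ := (Ideal.Quotient.mkₐ K (monomialIdeal K G)).toLinearMap with hφ
  let v : {a : Fin n →₀ ℕ // a.degree = i ∧ ∀ g ∈ G, ¬ g ≤ a} →
    (MvPolynomial (Fin n) K ⧸ monomialIdeal K G) := fun a => φ (monomial a.1 1)
  have hfin : Finite {a : Fin n →₀ ℕ // a.degree = i ∧ ∀ g ∈ G, ¬ g ≤ a} :=
    ((Finsupp.finite_of_degree_eq i).subset fun a ha => ha.1).to_subtype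
  have := Fintype.ofFinite {a : Fin n →₀ ℕ // a.degree = i ∧ ∀ g ∈ G, ¬ g ≤ a}
  have hli : LinearIndependent K v :=
    (linearIndependent_standardMonomials K G).comp
      (fun a : {a : Fin n →₀ ℕ // a.degree = i ∧ ∀ g ∈ G, ¬ g ≤ a} => ⟨a.1, a.2.2⟩)
      (fun a b hab => Subtype.ext (congrArg (fun x => x.1) hab))
  have hspan : (homogeneousSubmodule (Fin n) K i).map φ = Submodule.span K (Set.range v) := by
    apply le_antisymm
    · rw [Submodule.map_le_iff_le_comap]
      intro f hf
      rw [Submodule.mem_comap, f.as_sum, map_sum]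
      refine Submodule.sum_mem _ fun a ha => ?_
      have hdeg : a.degree = i := by
        have := hf (mem_support_iff.1 ha)
        rw [Finsupp.degree_eq_weight_one]
        exact this
      have hmon : monomial a (coeff a f) = coeff a f • monomial a (1 : K) := by
        rw [smul_monomial, smul_eq_mul, mul_one]
      rw [hmon, map_smul]
      refine Submodule.smul_mem _ _ ?_
      by_cases hG : ∀ g ∈ G, ¬ g ≤ a
      · exact Submodule.subset_span ⟨⟨a, hdeg, hG⟩, rfl⟩
      · push Not at hG
        have h0 : φ (monomial a (1 : K)) = 0 :=
          Ideal.Quotient.eq_zero_iff_mem.2 (monomial_mem_monomialIdeal.2 hG)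
        rw [h0]
        exact Submodule.zero_mem _
    · rw [Submodule.span_le]
      rintro _ ⟨a, rfl⟩
      exact ⟨_, isHomogeneous_monomial _ a.2.1, rfl⟩
  rw [hilbertFunction, ← hφ, hspan, finrank_span_eq_card hli, Nat.card_eq_fintype_card]

/-! ### Height and ideals generated by variables -/

/-- The endomorphism killing the variables in `X`. -/
noncomputable def killVars (K : Type*) [Field K] {n : ℕ} (X : Finset (Fin n)) :
    MvPolynomial (Fin n) K →ₐ[K] MvPolynomial (Fin n) K :=
  aeval fun i => if i ∈ X then 0 else MvPolynomial.X i

/-- Adding one variable at a time gives a strictly increasing chain of primes. -/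
theorem card_le_height_ker_killVars (K : Type*) [Field K] {n : ℕ} (X : Finset (Fin n)) :
    (X.card : ℕ∞) ≤ (RingHom.ker (killVars K X)).height := by
  classical
  induction X using Finset.induction_on with
  | empty => simp
  | insert i X hi ih =>
    have hprime : ∀ Y : Finset (Fin n), (RingHom.ker (killVars K Y)).IsPrime := fun Y =>
      RingHom.ker_isPrime _
    have := hprime X
    have := hprime (insert i X)
    have hcomp : (killVars K (insert i X)).comp (killVars K X) = killVars K (insert i X) := by
      refine algHom_ext fun j => ?_
      by_cases hj : j ∈ X <;> simp [killVars, hj]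
    have hlt : RingHom.ker (killVars K X) < RingHom.ker (killVars K (insert i X)) := by
      refine lt_of_le_of_ne (fun f hf => ?_) fun heq => ?_
      · rw [RingHom.mem_ker] at hf ⊢
        rw [← hcomp, AlgHom.comp_apply, hf, map_zero]
      · have h1 : (MvPolynomial.X i : MvPolynomial (Fin n) K) ∈
            RingHom.ker (killVars K (insert i X)) := by
          simp [RingHom.mem_ker, killVars]
        rw [← heq, RingHom.mem_ker] at h1
        simp [killVars, hi] at h1
    rw [Finset.card_insert_of_notMem hi, Nat.cast_add, Nat.cast_one]
    exact (add_le_add_left ih 1).trans (Ideal.height_add_one_le_of_lt_of_isPrime hlt)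

theorem ker_killVars_le {K : Type*} [Field K] {n : ℕ} {X : Finset (Fin n)}
    {J : Ideal (MvPolynomial (Fin n) K)} (hJ : ∀ x ∈ X, MvPolynomial.X x ∈ J) :
    RingHom.ker (killVars K X) ≤ J := by
  classical
  have hcomp : (Ideal.Quotient.mkₐ K J).comp (killVars K X) = Ideal.Quotient.mkₐ K J := by
    refine algHom_ext fun j => ?_
    by_cases hj : j ∈ X
    · have := Ideal.Quotient.eq_zero_iff_mem.2 (hJ j hj)
      simp [killVars, hj, this]
    · simp [killVars, hj]
  intro f hf
  have := DFunLike.congr_fun hcomp f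
  rw [AlgHom.comp_apply, (RingHom.mem_ker).1 hf, map_zero] at this
  exact Ideal.Quotient.eq_zero_iff_mem.1 this.symm

/-- A monomial ideal of height `c` is contained in an ideal generated by at most `c` variables. -/
theorem exists_finset_of_height_eq {K : Type*} [Field K] {n c : ℕ} {G : Set (Fin n →₀ ℕ)}
    (hc : (monomialIdeal K G).height = c) :
    ∃ X : Finset (Fin n), X.card ≤ c ∧ ∀ g ∈ G, ∃ x ∈ X, g x ≠ 0 := by
  classical
  obtain ⟨J, hJ, hle, hheight⟩ := Ideal.exists_isPrime_height_eq hc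
  -- `X` consists of the variables lying in a prime `J ⊇ M` of height `c`: they generate an ideal
  -- inside `J`, and a monomial in a prime has a variable factor in it.
  refine ⟨Finset.univ.filter fun x => (MvPolynomial.X x : MvPolynomial (Fin n) K) ∈ J, ?_, ?_⟩
  · have h1 := card_le_height_ker_killVars K
      (Finset.univ.filter fun x => (MvPolynomial.X x : MvPolynomial (Fin n) K) ∈ J)
    have h2 := Ideal.height_mono (ker_killVars_le (J := J)
      (X := Finset.univ.filter fun x => (MvPolynomial.X x : MvPolynomial (Fin n) K) ∈ J)
      (fun x hx => (Finset.mem_filter.1 hx).2))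
    rw [hheight] at h2
    exact_mod_cast h1.trans h2
  · intro g hg
    have hmem : monomial g (1 : K) ∈ J := hle (Ideal.subset_span ⟨g, hg, rfl⟩)
    rw [monomial_eq, C_1, one_mul, Finsupp.prod, hJ.prod_mem_iff] at hmem
    obtain ⟨x, hx, hxJ⟩ := hmem
    exact ⟨x, Finset.mem_filter.2 ⟨Finset.mem_univ _, hJ.mem_of_pow_mem _ hxJ⟩,
      Finsupp.mem_support_iff.1 hx⟩

/-! ### Minimal generators and dominance -/

/-- An `a ∈ G` is divisible by some `b ∈ G'`, and `b` by some `a' ∈ G`. If `a' ≠ a`, then `a` is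
redundant; otherwise `a = b`. Hence the minimal generating set is unique. -/
theorem IsMinimalMonomialGenSet.subset {K : Type*} [Field K] {n : ℕ}
    {M : Ideal (MvPolynomial (Fin n) K)} {G G' : Set (Fin n →₀ ℕ)}
    (hG : IsMinimalMonomialGenSet M G) (hG' : monomialIdeal K G' = M) : G ⊆ G' := by
  intro a ha
  have hGM : monomialIdeal K G = M := hG.1
  have h1 : monomial a (1 : K) ∈ monomialIdeal K G' := by
    rw [hG', ← hGM]
    exact monomial_mem_monomialIdeal.2 ⟨a, ha, le_rfl⟩
  obtain ⟨b, hb, hba⟩ := monomial_mem_monomialIdeal.1 h1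
  have h2 : monomial b (1 : K) ∈ monomialIdeal K G := by
    rw [hGM, ← hG']
    exact monomial_mem_monomialIdeal.2 ⟨b, hb, le_rfl⟩
  obtain ⟨a', ha', hab⟩ := monomial_mem_monomialIdeal.1 h2
  by_cases haa : a' = a
  · rw [le_antisymm (haa ▸ hab) hba]
    exact hb
  · exfalso
    have hgen : monomialIdeal K (G \ {a}) = M := by
      rw [← hGM]
      refine le_antisymm (Ideal.span_mono (Set.image_mono Set.sdiff_subset)) ?_
      refine Ideal.span_le.2 ?_
      rintro _ ⟨g, hg, rfl⟩
      refine monomial_mem_monomialIdeal.2 ?_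
      by_cases hga : g = a
      · exact ⟨a', ⟨ha', haa⟩, hga ▸ hab.trans hba⟩
      · exact ⟨g, ⟨hg, hga⟩, le_rfl⟩
    exact (hG.2 hgen Set.sdiff_subset ha).2 rfl

theorem finset_sup_apply {n : ℕ} {ι : Type*} (s : Finset ι) (m : ι → (Fin n →₀ ℕ)) (x : Fin n) :
    s.sup m x = s.sup fun i => m i x := by
  classical
  induction s using Finset.induction_on with
  | empty => rfl
  | insert i s hi ih => simp [Finset.sup_insert, ih]

/-- For `i ∈ s \ t`, the dominant variable of `m i` has a larger exponent in `lcm(s)` than in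
`lcm(t)`. -/
theorem injective_card_sup {n d : ℕ} {m : Fin d → (Fin n →₀ ℕ)} (hinj : m.Injective)
    (hdom : ∀ i, IsDominantIn (Set.range m) (m i)) :
    Function.Injective fun s : Finset (Fin d) => (s.card, s.sup m) := by
  intro s t hst
  obtain ⟨hcard, hsup⟩ := Prod.mk.inj hst
  refine Finset.eq_of_subset_of_card_le (fun i hi => ?_) hcard.ge
  by_contra hit
  obtain ⟨x, hx⟩ := hdom i
  have hlt : ∀ j ∈ t, m j x < m i x := fun j hj =>
    hx (m j) ⟨⟨j, rfl⟩, fun hji => hit (hinj hji ▸ hj)⟩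
  -- The cardinality is needed here: it excludes `t = ∅`, where the lcm could coincide if `m i = 1`.
  obtain ⟨j, hj⟩ : t.Nonempty := by
    rw [← Finset.card_pos, ← hcard, Finset.card_pos]
    exact ⟨i, hi⟩
  have h1 : t.sup m x < m i x := by
    rw [finset_sup_apply, Finset.sup_lt_iff ((Nat.zero_le _).trans_lt (hlt j hj))]
    exact hlt
  have h2 : m i x ≤ s.sup m x := Finset.le_sup (f := m) hi x
  rw [hsup] at h2
  omega

/-! ### Degrees of Hilbert–Samuel polynomials -/

theorem sum_hilbertFunction_monomialIdeal (K : Type*) [Field K] {n : ℕ} (G : Set (Fin n →₀ ℕ))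
    (t : ℕ) :
    ∑ i ∈ Finset.range (t + 1), hilbertFunction (monomialIdeal K G) i = standardCount G t := by
  classical
  rw [standardCount, Finset.card_eq_sum_card_fiberwise (f := fun a => a.degree)
    (t := Finset.range (t + 1))]
  · refine Finset.sum_congr rfl fun i hi => ?_
    rw [hilbertFunction_monomialIdeal, ← Nat.subtype_card]
    intro a
    rw [Finset.mem_range] at hi
    simp only [Finset.mem_filter, mem_degreeLE]
    constructor
    · exact fun H => ⟨H.2, H.1.2⟩
    · exact fun H => ⟨⟨by omega, H.2⟩, H.1⟩
  · intro a ha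
    simp only [Finset.mem_coe, Finset.mem_filter, mem_degreeLE, Finset.mem_range] at ha ⊢
    omega

theorem isHilbertSamuelPolynomial_monomialIdeal_iff (K : Type*) [Field K] {n : ℕ}
    {G : Set (Fin n →₀ ℕ)} {P : Polynomial ℚ} :
    IsHilbertSamuelPolynomial (monomialIdeal K G) P ↔
      ∀ᶠ t : ℕ in Filter.atTop, P.eval (t : ℚ) = standardCount G t := by
  simp only [IsHilbertSamuelPolynomial, ← Nat.cast_sum, sum_hilbertFunction_monomialIdeal]

theorem le_natDegree_of_eventually_eq_standardCount {n : ℕ} {G : Set (Fin n →₀ ℕ)}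
    {P : Polynomial ℚ}
    (hP : ∀ᶠ t : ℕ in Filter.atTop, P.eval (t : ℚ) = standardCount G t) (X : Finset (Fin n))
    (hX : ∀ g ∈ G, ∃ x ∈ X, g x ≠ 0) : n - X.card ≤ P.natDegree := by
  have hle := choose_le_standardCount X hX
  have hval : ∀ t : ℕ, (Polynomial.preHilbertPoly ℚ (n - X.card) 0).eval (t : ℚ) =
      (t + (n - X.card)).choose (n - X.card) := fun t => by
    rw [Polynomial.preHilbertPoly_eq_choose_sub_add ℚ _ (Nat.zero_le t), Nat.sub_zero]
  rw [← Polynomial.natDegree_preHilbertPoly ℚ (n - X.card) 0]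
  refine natDegree_le_of_eventually_le ?_ (.of_forall fun t => ?_) ?_
  · intro h0
    have := hval 0
    simp [h0] at this
  · rw [hval]
    positivity
  · filter_upwards [hP] with t ht
    rw [hval, ht]
    exact_mod_cast hle t

theorem natDegree_le_of_eventually_eq_standardCount {n c : ℕ} {h : Fin c → (Fin n →₀ ℕ)}
    (hdisj : ∀ i j x, h i x ≠ 0 → h j x ≠ 0 → i = j) {P : Polynomial ℚ}
    (hP : ∀ᶠ t : ℕ in Filter.atTop, P.eval (t : ℚ) = standardCount (Set.range h) t) :
    P.natDegree ≤ n - c := by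
  obtain ⟨E, hE⟩ := exists_standardCount_le h hdisj
  by_cases h0 : P = 0
  · simp [h0]
  have hQ : (Polynomial.C (E : ℚ) * (Polynomial.X + Polynomial.C 1) ^ (n - c)).natDegree ≤
      n - c :=
    (Polynomial.natDegree_C_mul_le _ _).trans
      (Polynomial.natDegree_pow_le.trans (by rw [Polynomial.natDegree_X_add_C, mul_one]))
  refine (natDegree_le_of_eventually_le h0 ?_ ?_).trans hQ
  · filter_upwards [hP] with t ht
    rw [ht]
    positivity
  · filter_upwards [hP] with t ht
    rw [ht]
    simp only [Polynomial.eval_mul, Polynomial.eval_C, Polynomial.eval_pow, Polynomial.eval_add,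
      Polynomial.eval_X]
    exact_mod_cast hE t

/-- Allowing `P = 0` lets unit ideals be read off in the same degree `k` as all the others. -/
theorem hilbertMultiplicity_eq_factorial_mul_coeff {K : Type*} [Field K] {n : ℕ}
    {I : Ideal (MvPolynomial (Fin n) K)} {P : Polynomial ℚ} (hP : IsHilbertSamuelPolynomial I P)
    {k : ℕ} (hk : P = 0 ∨ P.natDegree = k) :
    hilbertMultiplicity I = (k.factorial : ℚ) * P.coeff k := by
  rw [hilbertMultiplicity_eq hP]
  rcases hk with rfl | rfl
  · simp
  · rfl

/-- The Hilbert–Samuel polynomial of a monomial complete intersection is `0` (for the unit ideal)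
or has degree `n - c`. -/
theorem eq_zero_or_natDegree_eq {n c : ℕ} {h : Fin c → (Fin n →₀ ℕ)}
    (hdisj : ∀ i j x, h i x ≠ 0 → h j x ≠ 0 → i = j) {P : Polynomial ℚ}
    (hP : ∀ᶠ t : ℕ in Filter.atTop, P.eval (t : ℚ) = standardCount (Set.range h) t) :
    P = 0 ∨ P.natDegree = n - c := by
  classical
  by_cases hne : ∃ i, h i = 0
  · left
    obtain ⟨i, hi⟩ := hne
    have hz : ∀ t, standardCount (Set.range h) t = 0 := by
      intro t
      rw [standardCount, Finset.card_eq_zero, Finset.filter_eq_empty_iff]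
      exact fun a _ H => H (h i) ⟨i, rfl⟩ (hi ▸ zero_le)
    by_contra h0
    have hroot := (tendsto_natCast_atTop_atTop (R := ℚ)).eventually
      (Polynomial.eventually_atTop_not_isRoot P h0)
    obtain ⟨t, ht, ht'⟩ := (hP.and hroot).exists
    exact ht' (ht.trans (by simp [hz]))
  · right
    push Not at hne
    choose x hx using fun i => Finsupp.ne_iff.1 (hne i)
    refine le_antisymm (natDegree_le_of_eventually_eq_standardCount hdisj hP) ?_
    -- One variable from each `h i` gives at most `c` variables meeting every generator.
    have hcard : (Finset.univ.image x).card ≤ c :=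
      Finset.card_image_le.trans (by rw [Finset.card_univ, Fintype.card_fin])
    refine (Nat.sub_le_sub_left hcard n).trans
      (le_natDegree_of_eventually_eq_standardCount hP _ ?_)
    rintro _ ⟨i, rfl⟩
    exact ⟨x i, Finset.mem_image_of_mem _ (Finset.mem_univ _), hx i⟩

/-! ### Regular sequences of monomials -/

theorem ofList_take_ofFn_monomial (K : Type*) [Field K] {n c : ℕ} (h : Fin c → (Fin n →₀ ℕ))
    (k : ℕ) :
    Ideal.ofList ((List.ofFn fun i => monomial (h i) (1 : K)).take k) =
      monomialIdeal K (h '' {i | i.1 < k}) := by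
  rw [Ideal.ofList, monomialIdeal]
  congr 1
  ext f
  simp only [Set.mem_ofPred_eq, Set.mem_image, List.mem_take_iff_getElem, List.getElem_ofFn,
    List.length_ofFn, exists_exists_and_eq_and]
  constructor
  · rintro ⟨i, hi, rfl⟩
    exact ⟨⟨i, by omega⟩, by simpa using (by omega : i < k), rfl⟩
  · rintro ⟨i, hi, rfl⟩
    exact ⟨i.1, by have := i.2; omega, rfl⟩

/-- The monomials of a regular sequence are different from `1` and have disjoint supports. -/
theorem ne_zero_and_disjoint_of_isRegular {K : Type*} [Field K] {n c : ℕ}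
    {h : Fin c → (Fin n →₀ ℕ)}
    (hreg : RingTheory.Sequence.IsRegular (MvPolynomial (Fin n) K)
      (List.ofFn fun i => monomial (h i) (1 : K))) :
    (∀ i, h i ≠ 0) ∧ ∀ i j x, h i x ≠ 0 → h j x ≠ 0 → i = j := by
  have hne : ∀ i, h i ≠ 0 := by
    intro i hi
    apply hreg.top_ne_smul
    have h1 : (1 : MvPolynomial (Fin n) K) ∈
        Ideal.ofList (List.ofFn fun i => monomial (h i) (1 : K)) := by
      refine Ideal.subset_span ?_
      rw [Set.mem_ofPred_eq, List.mem_ofFn]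
      exact ⟨i, by rw [hi]; rfl⟩
    rw [(Ideal.eq_top_iff_one _).2 h1, smul_eq_mul, Ideal.mul_top]
  have hcancel : ∀ (k : Fin c) (a : Fin n →₀ ℕ), (∃ i < k, h i ≤ h k + a) →
      ∃ i < k, h i ≤ a := by
    rintro k a ⟨i, hik, hle⟩
    have hk := hreg.regular_mod_prev k.1 (by simp)
    rw [isSMulRegular_quotient_iff_mem_of_smul_mem] at hk
    have := hk (monomial a 1)
    rw [smul_eq_mul, Ideal.mul_top, ofList_take_ofFn_monomial, List.getElem_ofFn, smul_eq_mul,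
      monomial_mul, one_mul, monomial_mem_monomialIdeal, monomial_mem_monomialIdeal] at this
    obtain ⟨_, ⟨j, hj, rfl⟩, hja⟩ := this ⟨_, ⟨i, hik, rfl⟩, hle⟩
    exact ⟨j, hj, hja⟩
  have hlt : ∀ k : ℕ, ∀ i j : Fin c, i < j → j.1 = k → ∀ x, h i x ≠ 0 → h j x ≠ 0 → False := by
    intro k
    induction k using Nat.strong_induction_on with
    | _ k ih =>
      rintro i j hij rfl x hix hjx
      -- If `x` divides `h i` and `h j`, then `h i` divides `h j * (h i / x)`, so some `h l` with `l
      -- < j` divides `h i / x`. Then `l ≠ i`, and `h l`, `h i` share a variable; both indices are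
      -- below `j`, so induction on the larger index applies.
      obtain ⟨l, hl, hle⟩ := hcancel j (h i - Finsupp.single x 1) ⟨i, hij, fun y => by
        rw [Finsupp.add_apply, Finsupp.tsub_apply, Finsupp.single_apply]
        split_ifs with hxy
        · subst hxy
          omega
        · omega⟩
      obtain ⟨y, hy⟩ := Finsupp.ne_iff.1 (hne l)
      rw [Finsupp.coe_zero, Pi.zero_apply] at hy
      have hiy : h i y ≠ 0 := by
        have := hle y
        rw [Finsupp.tsub_apply] at this
        omega
      rcases lt_trichotomy l i with hli | rfl | hli
      · exact ih i.1 hij l i hli rfl y hy hiy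
      · have := hle x
        rw [Finsupp.tsub_apply, Finsupp.single_eq_same] at this
        omega
      · exact ih l.1 hl i l hli rfl y hiy hy
  refine ⟨hne, fun i j x hix hjx => ?_⟩
  rcases lt_trichotomy i j with hij | hij | hij
  · exact (hlt _ i j hij rfl x hix hjx).elim
  · exact hij
  · exact (hlt _ j i hij rfl x hjx hix).elim

/-! ### Comparing coefficients in degree `n - c` -/

theorem coeff_comp_X_sub_C {P : Polynomial ℚ} {k : ℕ} (hk : P.natDegree ≤ k) (r : ℚ) :
    (P.comp (Polynomial.X - Polynomial.C r)).coeff k = P.coeff k := by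
  have h1 := Polynomial.natDegree_comp (p := P) (q := Polynomial.X - Polynomial.C r)
  rw [Polynomial.natDegree_X_sub_C, mul_one] at h1
  rcases hk.lt_or_eq with hlt | rfl
  · rw [Polynomial.coeff_eq_zero_of_natDegree_lt hlt,
      Polynomial.coeff_eq_zero_of_natDegree_lt (h1 ▸ hlt)]
  · have := Polynomial.coeff_comp_degree_mul_degree (p := P)
      (q := Polynomial.X - Polynomial.C r) (by rw [Polynomial.natDegree_X_sub_C]; exact one_ne_zero)
    rwa [Polynomial.natDegree_X_sub_C, mul_one, Polynomial.leadingCoeff_X_sub_C, one_pow,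
      mul_one] at this

theorem hilbertMultiplicity_eq_sum {K : Type*} [Field K] {n c d : ℕ}
    {m : Fin d → (Fin n →₀ ℕ)} {h : Fin c → (Fin n →₀ ℕ)}
    (hcodim : (monomialIdeal K (Set.range m ∪ Set.range h)).height = c)
    (hdisj : ∀ i j x, h i x ≠ 0 → h j x ≠ 0 → i = j) :
    hilbertMultiplicity (monomialIdeal K (Set.range m ∪ Set.range h)) =
      ∑ s : Finset (Fin d), (-1 : ℚ) ^ s.card *
        hilbertMultiplicity (quotientIdeal K h (s.sup m)) := by
  let h' : Finset (Fin d) → Fin c → (Fin n →₀ ℕ) := fun s i => (s.sup m ⊔ h i) - s.sup m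
  have hsupp : ∀ s i x, h' s i x ≠ 0 → h i x ≠ 0 := by
    intro s i x hx
    simp only [h', Finsupp.tsub_apply, Finsupp.sup_apply] at hx
    omega
  have hdisj' : ∀ s i j x, h' s i x ≠ 0 → h' s j x ≠ 0 → i = j := fun s i j x hi hj =>
    hdisj i j x (hsupp s i x hi) (hsupp s j x hj)
  choose P hP using fun s => exists_polynomial_standardCount (h' s)
  have hdeg : ∀ s, (P s).natDegree ≤ n - c := fun s =>
    natDegree_le_of_eventually_eq_standardCount (hdisj' s) (hP s)
  let Q : Polynomial ℚ := ∑ s : Finset (Fin d), Polynomial.C ((-1 : ℚ) ^ s.card) *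
    (P s).comp (Polynomial.X - Polynomial.C ((s.sup m).degree : ℚ))
  have hQ : ∀ᶠ t : ℕ in Filter.atTop,
      Q.eval (t : ℚ) = standardCount (Set.range m ∪ Set.range h) t := by
    filter_upwards [Filter.eventually_all.2 fun s : Finset (Fin d) =>
        Filter.eventually_ge_atTop (s.sup m).degree,
      Filter.eventually_all.2 fun s : Finset (Fin d) =>
        (Filter.tendsto_sub_atTop_nat (s.sup m).degree).eventually (hP s)] with t ht hPt
    rw [standardCount_union m h ht, Polynomial.eval_finsetSum]
    refine Finset.sum_congr rfl fun s _ => ?_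
    rw [Polynomial.eval_mul, Polynomial.eval_C, Polynomial.eval_comp, Polynomial.eval_sub,
      Polynomial.eval_X, Polynomial.eval_C, ← Nat.cast_sub (ht s), hPt s]
  have hQle : Q.natDegree ≤ n - c := by
    refine Polynomial.natDegree_sum_le_of_forall_le _ _ fun s _ => ?_
    refine (Polynomial.natDegree_C_mul_le _ _).trans ?_
    rw [Polynomial.natDegree_comp, Polynomial.natDegree_X_sub_C, mul_one]
    exact hdeg s
  -- The alternating sum could cancel in degree `n - c`; the height of `M` rules this out.
  have hQge : n - c ≤ Q.natDegree := by
    obtain ⟨X, hXc, hX⟩ := exists_finset_of_height_eq hcodim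
    exact (Nat.sub_le_sub_left hXc n).trans
      (le_natDegree_of_eventually_eq_standardCount hQ X hX)
  rw [hilbertMultiplicity_eq_factorial_mul_coeff
    ((isHilbertSamuelPolynomial_monomialIdeal_iff K).2 hQ) (.inr (le_antisymm hQle hQge)),
    Polynomial.finsetSum_coeff, Finset.mul_sum]
  refine Finset.sum_congr rfl fun s _ => ?_
  rw [Polynomial.coeff_C_mul, coeff_comp_X_sub_C (hdeg s), quotientIdeal,
    hilbertMultiplicity_eq_factorial_mul_coeff
      ((isHilbertSamuelPolynomial_monomialIdeal_iff K).2 (hP s))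
      (eq_zero_or_natDegree_eq (hdisj' s) (hP s))]
  ring

end MonomialMultiplicity

theorem mainTheorem4 {K : Type*} [Field K] {n c d : ℕ}
    (M : Ideal (MvPolynomial (Fin n) K))
    (m : Fin d → (Fin n →₀ ℕ)) (h : Fin c → (Fin n →₀ ℕ))
    (hdom : MonomialMultiplicity.IsDominantIdeal M)
    (hcodim : M.height = c)
    (hM : M = MonomialMultiplicity.monomialIdeal K (Set.range m ∪ Set.range h))
    (hci : RingTheory.Sequence.IsRegular (MvPolynomial (Fin n) K)
      (List.ofFn fun i => MvPolynomial.monomial (h i) (1 : K))) :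
    MonomialMultiplicity.hilbertMultiplicity M =
        ∑ s : Finset (Fin d), (-1 : ℚ) ^ s.card *
          MonomialMultiplicity.hilbertMultiplicity
            (MonomialMultiplicity.quotientIdeal K h (s.sup m)) ∧
      (Function.Injective (Sum.elim m h) →
        MonomialMultiplicity.IsMinimalMonomialGenSet M (Set.range m ∪ Set.range h) →
        MonomialMultiplicity.hilbertMultiplicity M =
          ∑ p ∈ MonomialMultiplicity.lcmPairs m, (-1 : ℚ) ^ p.1 *
            MonomialMultiplicity.hilbertMultiplicity
              (MonomialMultiplicity.quotientIdeal K h p.2)) := by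
  subst hM
  have hsum := MonomialMultiplicity.hilbertMultiplicity_eq_sum hcodim
    (MonomialMultiplicity.ne_zero_and_disjoint_of_isRegular hci).2
  refine ⟨hsum, fun hinj hmin => ?_⟩
  obtain ⟨G, hG, hGdom⟩ := hdom
  have hGeq : G = Set.range m ∪ Set.range h :=
    Set.Subset.antisymm (hG.subset hmin.1) (hmin.subset hG.1)
  subst hGeq
  have hmdom : ∀ i, MonomialMultiplicity.IsDominantIn (Set.range m) (m i) := fun i =>
    (hGdom (m i) (.inl ⟨i, rfl⟩)).imp fun x hx b hb => hx b ⟨.inl hb.1, hb.2⟩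
  have hminj : m.Injective := fun i j hij => Sum.inl_injective (hinj hij)
  rw [hsum, MonomialMultiplicity.lcmPairs, Finset.sum_image
    (MonomialMultiplicity.injective_card_sup hminj hmdom).injOn]
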